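/- **Landscape Decomposition Theorem.** A *landscape curve* is a function $f:\mathbb R\to\mathbb R$ that is non-negative, continuous, piecewise linear and compactly supported, that is differentiable except at finitely many points, and whose derivative is $+1$ or $-1$ at every point of its support where it is differentiable. For a sequence $\lambda=(\lambda_1,\lambda_2,\dots)$ of functions $\mathbb R\to\mathbb R$ and a point $(t,h)\in\mathbb R^2$ put $$\deg_\lambda(t,h)=\bigl|\{k : (t,h)\text{ is a local maximum of }\lambda_k\}\bigr|-\bigl|\{k : (t,h)\text{ is a local minimum of }\lambda_k\}\bigr| .$$ A *landscape sequence* is a sequence $\lambda$ of landscape curves such that $\lambda_k\ge\lambda_{k+1}$ for all $k$, such that $\lambda_k=0$ for all sufficiently large $k$, and such that $\deg_\lambda(t,h)\ge 0$ whenever $h>0$. The *direct sum* $\eta\oplus\mu$ of two sequences is the sequence whose $k$-th member at $t$ is the $k$-th largest element (counted with multiplicity) of $\eta_1(t),\dots,\eta_k(t),\mu_1(t),\dots,\mu_k(t)$. For $b<d$ the *tent function* $f_{(b,d)}$ equals $t-b$ for $t\in(b,\frac{b+d}2]$, $d-t$ for $t\in(\frac{b+d}2,d)$, and $0$ otherwise;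 it is identified with the sequence $(f_{(b,d)},0,0,\dots)$. A finite direct sum of tent functions is $f_{(b_1,d_1)}\oplus\bigl(f_{(b_2,d_2)}\oplus(\cdots\oplus f_{(b_N,d_N)})\bigr)$, the empty one being the zero sequence. 1. If $\eta$ and $\mu$ are landscape sequences, then so is $\eta\oplus\mu$. 2. Let $\lambda$ be a landscape sequence. There is a finite list $(b_1,d_1),\dots,(b_N,d_N)$ of pairs with $b_i<d_i$, possibly empty, such that $$\lambda=\bigoplus_{i=1}^N f_{(b_i,d_i)},$$ and every pair $(b,d)$ with $b<d$ occurs in the list exactly $\deg_\lambda\bigl(\frac{b+d}2,\frac{d-b}2\bigr)$ times; in particular this degree is positive for every pair in the list. The decomposition is unique up to reordering: a finite list of pairs $(b,d)$ with $b<d$ has direct sum $\lambda$ if and only if it is a reordering of the list above. -/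

import Mathlib

namespace Landscape

noncomputable section

/-- `f` is piecewise linear: there is a finite set `S` of break points such that `f` is affine on
every closed interval whose interior contains no break point. -/
def IsPiecewiseLinear (f : ℝ → ℝ) : Prop :=
  ∃ S : Finset ℝ, ∀ x y : ℝ, x ≤ y → (∀ s ∈ S, s ∉ Set.Ioo x y) →
    ∃ m c : ℝ, ∀ t ∈ Set.Icc x y, f t = m * t + c

/-- Landscape curves. The critical points are the points of non-differentiability. -/
structure IsLandscapeCurve (f : ℝ → ℝ) : Prop where
  nonneg : ∀ t, 0 ≤ f t
  continuous : Continuous f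
  piecewiseLinear : IsPiecewiseLinear f
  compactSupport : HasCompactSupport f
  finite_critical : {t : ℝ | ¬ DifferentiableAt ℝ f t}.Finite
  deriv_eq : ∀ t ∈ tsupport f, DifferentiableAt ℝ f t → deriv f t = 1 ∨ deriv f t = -1

/-- The degree of the point `(t, h)` in the sequence `lam`: the number of members of the sequence
that have a local maximum at `(t, h)` minus the number of those that have a local minimum there.
It is only used for `h > 0`, where both sets are finite for a landscape sequence. -/
def degree (lam : ℕ → ℝ → ℝ) (t h : ℝ) : ℤ :=
  ({k : ℕ | lam k t = h ∧ IsLocalMax (lam k) t}.ncard : ℤ) -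
    ({k : ℕ | lam k t = h ∧ IsLocalMin (lam k) t}.ncard : ℤ)

/-- Landscape sequences `(λ₁, λ₂, …)`. Indices start at `0`, so that `lam k` is `λ_{k+1}`. -/
structure IsLandscapeSequence (lam : ℕ → ℝ → ℝ) : Prop where
  curve : ∀ k, IsLandscapeCurve (lam k)
  monotonicity : ∀ k t, lam (k + 1) t ≤ lam k t
  finite_support : ∃ K : ℕ, ∀ k, K ≤ k → lam k = 0
  degree_nonneg : ∀ t h : ℝ, 0 < h → 0 ≤ degree lam t h

/-- The `(k+1)`-st largest element, with multiplicity, of a finite multiset of reals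
(and `0` if the multiset has at most `k` elements). -/
def kmax (k : ℕ) (s : Multiset ℝ) : ℝ :=
  (s.sort (· ≥ ·)).getD k 0

/-- The direct sum `η ⊕ μ`, whose `k`-th member is (for `k ≥ 1`) the pointwise `k`-th largest of
`η₁, …, η_k, μ₁, …, μ_k`; with indices starting at `0`, member `k` uses members `0, …, k`. -/
def directSum (η μ : ℕ → ℝ → ℝ) : ℕ → ℝ → ℝ := fun k t =>
  kmax k ((Multiset.range (k + 1)).map (fun i => η i t) +
    (Multiset.range (k + 1)).map (fun i => μ i t))

/-- Birth-death pairs: points `(b, d)` of the plane with `b < d`. -/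
abbrev BirthDeathPair : Type := {p : ℝ × ℝ // p.1 < p.2}

/-- The tent function `f_{(b,d)}`. -/
def tent (b d : ℝ) : ℝ → ℝ := fun t =>
  if b < t ∧ t ≤ (b + d) / 2 then t - b
  else if (b + d) / 2 < t ∧ t < d then d - t
  else 0

/-- The sequence `(f_{(b,d)}, 0, 0, …)` associated with a tent function. -/
def tentSequence (p : BirthDeathPair) : ℕ → ℝ → ℝ := fun k =>
  if k = 0 then tent p.1.1 p.1.2 else 0

/-- The finite direct sum `f_{(b₁,d₁)} ⊕ (f_{(b₂,d₂)} ⊕ (⋯ ⊕ f_{(b_N,d_N)}))` of the tent sequences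
of a list of pairs; the empty direct sum is the zero sequence, which is neutral for `⊕`. -/
def tentSum : List BirthDeathPair → ℕ → ℝ → ℝ
  | [] => 0
  | p :: L => directSum (tentSequence p) (tentSum L)

/-- The degree in `lam` of the apex `((b+d)/2, (d-b)/2)` of the tent function `f_{(b,d)}`. -/
def apexDegree (lam : ℕ → ℝ → ℝ) (p : BirthDeathPair) : ℤ :=
  degree lam ((p.1.1 + p.1.2) / 2) ((p.1.2 - p.1.1) / 2)

end

end Landscape

/-!
The proof replaces a sequence `λ` by its rank function `rank λ t h = #{k | h ≤ λ k t}`, for `h > 0`.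
It determines `λ`, and it turns direct sums into sums (`rank_directSum`).

A landscape curve is affine with outward slope `±1` on each side of every point where it is positive
(`IsLandscapeCurve.hasUnitGerm`). Hence, near a point `(t, h)` with `h > 0`, the indicator of the
region under the curve depends only on the signs of `b' - b` and `d' - d` in the coordinates
`b = t - h`, `d = t + h`. It is a linear combination of `1`, the two half-plane indicators
`[b ≤ b']` and `[d' ≤ d]`, and the quadrant indicator `[b ≤ b' and d' ≤ d]`. The coefficient of the
quadrant is `1` at a local maximum, `-1` at a local minimum, because
`[A or B] = [A] + [B] - [A and B]`, and `0` otherwise (`IsLandscapeCurve.hasCorner`). Summing over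
the curves, the degree of `λ` at `(t, h)` is the quadrant coefficient of the rank function, which is
unique (`HasCorner.unique`); so the degree is additive under `⊕`. That `⊕` preserves landscape
curves holds because order statistics are built from maxima and minima, and because landscape curves
are the nonnegative compactly supported functions with the one-sided germs above
(`isLandscapeCurve_of_germs`). This gives the first part.

A landscape sequence is determined by its degrees (`eq_of_degree_eq`): if two sequences have the same
degrees and the set where their rank functions differ is nonempty, its closure is compact and has a
highest point. There the difference of the rank functions has quadrant coefficient `0`, and it
vanishes above, which forces the other three coefficients to be `0`. So the difference vanishes near
that point, a contradiction.

The tent of a pair has degree `1` at its apex and `0` at every other point of positive height, so the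
degrees of a direct sum of tents count the multiplicities in the list (`apexDegree_tentSum`). The
degrees of a landscape sequence are nonnegative, and nonzero at finitely many points only, since a
local extremum of positive height is a critical point. They are therefore the multiplicities of a
list, whose direct sum is `λ`. Uniqueness holds since the degrees determine the multiplicities.
-/

open Filter Topology Set

namespace Landscape

/-! ### One-sided germs of landscape curves -/

/-- On the side of `t` given by the direction `u = 1` or `u = -1`, the function `f` is affine with
outward slope `1`, `-1` or `0`, and slope `0` occurs only where `f` vanishes. -/
def HasUnitGerm (f : ℝ → ℝ) (t u : ℝ) : Prop :=
  ∃ σ : ℝ, (σ = 1 ∨ σ = -1 ∨ (σ = 0 ∧ f t = 0)) ∧ ∀ᶠ ε in 𝓝[>] (0 : ℝ), f (t + u * ε) = f t + σ * ε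

lemma tendsto_ray (t u : ℝ) : Tendsto (fun ε : ℝ => t + u * ε) (𝓝[>] (0 : ℝ)) (𝓝 t) := by
  have h : Continuous (fun ε : ℝ => t + u * ε) := by fun_prop
  have := h.tendsto 0
  simp only [mul_zero, add_zero] at this
  exact this.mono_left nhdsWithin_le_nhds

lemma hasUnitGerm_of_affine {f : ℝ → ℝ} {m c u : ℝ} (hf : ∀ t, f t = m * t + c)
    (hm : m = 1 ∨ m = -1) (hu : u = 1 ∨ u = -1) (t : ℝ) : HasUnitGerm f t u := by
  refine ⟨m * u, ?_, Eventually.of_forall fun ε => ?_⟩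
  · rcases hm with rfl | rfl <;> rcases hu with rfl | rfl <;> norm_num
  · rw [hf, hf]; ring

lemma hasUnitGerm_zero (t u : ℝ) : HasUnitGerm (fun _ => 0) t u :=
  ⟨0, Or.inr (Or.inr ⟨rfl, rfl⟩), Eventually.of_forall fun ε => by simp⟩

/-- Of two germs with different values the larger one dominates; for equal values the larger slope
does. -/
lemma HasUnitGerm.sup {f g : ℝ → ℝ} {t u : ℝ} (hf : HasUnitGerm f t u) (hg : HasUnitGerm g t u) :
    HasUnitGerm (fun s => max (f s) (g s)) t u := by
  wlog h : f t ≤ g t generalizing f g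
  · simpa only [max_comm] using this hg hf (le_of_not_ge h)
  obtain ⟨σ, hσ, hf'⟩ := hf
  obtain ⟨τ, hτ, hg'⟩ := hg
  have hpos : ∀ᶠ ε in 𝓝[>] (0 : ℝ), 0 < ε := self_mem_nhdsWithin
  rcases h.lt_or_eq with h | h
  · refine ⟨τ, by simpa only [max_eq_right h.le] using hτ, ?_⟩
    have h1 : ∀ᶠ ε in 𝓝[>] (0 : ℝ), 0 + (σ - τ) * ε < g t - f t :=
      (tendsto_ray 0 (σ - τ)).eventually (gt_mem_nhds (sub_pos.2 h))
    filter_upwards [hf', hg', h1] with ε e1 e2 e3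
    rw [e1, e2, max_eq_right h.le, max_eq_right]
    linarith
  · refine ⟨max σ τ, ?_, ?_⟩
    · rw [h] at hσ
      rcases max_choice σ τ with e | e <;> rw [e] <;> simp only [h, max_self] <;> assumption
    · filter_upwards [hf', hg', hpos] with ε e1 e2 e3
      rw [e1, e2, h, max_self, max_mul_of_nonneg _ _ e3.le, max_add_add_left]

lemma HasUnitGerm.neg {f : ℝ → ℝ} {t u : ℝ} (hf : HasUnitGerm f t u) :
    HasUnitGerm (fun s => -f s) t u := by
  obtain ⟨σ, hσ, hf'⟩ := hf
  refine ⟨-σ, ?_, ?_⟩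
  · rcases hσ with rfl | rfl | ⟨rfl, h⟩ <;> simp [*]
  · filter_upwards [hf'] with ε e1
    rw [e1]; ring

lemma HasUnitGerm.inf {f g : ℝ → ℝ} {t u : ℝ} (hf : HasUnitGerm f t u) (hg : HasUnitGerm g t u) :
    HasUnitGerm (fun s => min (f s) (g s)) t u := by
  have := (hf.neg.sup hg.neg).neg
  simpa only [max_neg_neg, neg_neg] using this

/-- At a point of differentiability the outward slope in direction `u` is `u` times the
derivative. -/
lemma slope_eq_deriv {f : ℝ → ℝ} {t u σ : ℝ} (hd : DifferentiableAt ℝ f t)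
    (hf : ∀ᶠ ε in 𝓝[>] (0 : ℝ), f (t + u * ε) = f t + σ * ε) : σ = deriv f t * u := by
  have h1 : HasDerivAt (fun ε : ℝ => f (t + u * ε)) (deriv f t * u) 0 := by
    have h2 : HasDerivAt (fun ε : ℝ => t + u * ε) u 0 := by
      simpa using ((hasDerivAt_id (0 : ℝ)).const_mul u).const_add t
    have h3 : HasDerivAt f (deriv f t) (t + u * 0) := by simpa using hd.hasDerivAt
    exact h3.comp 0 h2
  have h4 : HasDerivAt (fun ε : ℝ => f t + σ * ε) σ 0 := by
    simpa using ((hasDerivAt_id (0 : ℝ)).const_mul σ).const_add (f t)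
  have h5 : HasDerivWithinAt (fun ε : ℝ => f (t + u * ε)) σ (Ioi 0) 0 :=
    h4.hasDerivWithinAt.congr_of_eventuallyEq hf (by simp)
  exact ((uniqueDiffWithinAt_Ioi (0 : ℝ)).eq_deriv _ h5 h1.hasDerivWithinAt)

/-- The two one-sided germs in one formula. -/
lemma eventually_eq_of_germs {f : ℝ → ℝ} {t σ τ : ℝ}
    (hr : ∀ᶠ ε in 𝓝[>] (0 : ℝ), f (t + 1 * ε) = f t + σ * ε)
    (hl : ∀ᶠ ε in 𝓝[>] (0 : ℝ), f (t + -1 * ε) = f t + τ * ε) :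
    ∀ᶠ s in 𝓝 t, f s = f t + if t ≤ s then σ * (s - t) else τ * (t - s) := by
  obtain ⟨a, ha, hr⟩ := mem_nhdsGT_iff_exists_Ioo_subset.1 hr
  obtain ⟨b, hb, hl⟩ := mem_nhdsGT_iff_exists_Ioo_subset.1 hl
  have ha : 0 < a := ha
  have hb : 0 < b := hb
  filter_upwards [Ioo_mem_nhds (show t - b < t by linarith) (show t < t + a by linarith)] with s hs
  rcases lt_trichotomy t s with h | rfl | h
  · have := hr (show s - t ∈ Ioo 0 a from ⟨by linarith, by linarith [hs.2]⟩)
    simp only [mem_ofPred_eq] at this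
    rw [if_pos h.le, ← this]; ring_nf
  · simp
  · have := hl (show t - s ∈ Ioo 0 b from ⟨by linarith, by linarith [hs.1]⟩)
    simp only [mem_ofPred_eq] at this
    rw [if_neg (not_le.2 h), ← this]; ring_nf

lemma exists_affine_of_differentiableAt {f : ℝ → ℝ} {t : ℝ} (hr : HasUnitGerm f t 1)
    (hl : HasUnitGerm f t (-1)) (hd : DifferentiableAt ℝ f t) :
    (deriv f t = 1 ∨ deriv f t = -1 ∨ (deriv f t = 0 ∧ f t = 0)) ∧
      ∀ᶠ s in 𝓝 t, f s = f t + deriv f t * (s - t) := by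
  obtain ⟨σ, hσ, hr⟩ := hr
  obtain ⟨τ, hτ, hl⟩ := hl
  have e1 := slope_eq_deriv hd hr
  have e2 := slope_eq_deriv hd hl
  refine ⟨by simpa [e1] using hσ, ?_⟩
  filter_upwards [eventually_eq_of_germs hr hl] with s hs
  rw [hs, e1, e2]
  split_ifs <;> ring

lemma differentiableAt_near_of_germ {f : ℝ → ℝ} {t : ℝ} (hr : HasUnitGerm f t 1)
    (hl : HasUnitGerm f t (-1)) : ∀ᶠ s in 𝓝[≠] t, DifferentiableAt ℝ f s := by
  obtain ⟨σ, hσ, hr⟩ := hr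
  obtain ⟨τ, hτ, hl⟩ := hl
  have h := (eventually_eq_of_germs hr hl).eventually_nhds
  filter_upwards [h.filter_mono nhdsWithin_le_nhds, self_mem_nhdsWithin] with s hs hne
  rcases lt_or_gt_of_ne (show s ≠ t from hne) with hlt | hlt
  · have : f =ᶠ[𝓝 s] fun x => f t + τ * (t - x) := by
      filter_upwards [hs, gt_mem_nhds hlt] with x hx hx'
      rw [hx, if_neg (not_le.2 hx')]
    exact DifferentiableAt.congr_of_eventuallyEq (by fun_prop) this
  · have : f =ᶠ[𝓝 s] fun x => f t + σ * (x - t) := by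
      filter_upwards [hs, lt_mem_nhds hlt] with x hx hx'
      rw [hx, if_pos (le_of_lt hx')]
    exact DifferentiableAt.congr_of_eventuallyEq (by fun_prop) this

lemma continuousAt_of_germ {f : ℝ → ℝ} {t : ℝ} (hr : HasUnitGerm f t 1)
    (hl : HasUnitGerm f t (-1)) : ContinuousAt f t := by
  obtain ⟨σ, hσ, hr⟩ := hr
  obtain ⟨τ, hτ, hl⟩ := hl
  have hc : Continuous fun s => f t + if t ≤ s then σ * (s - t) else τ * (t - s) :=
    continuous_const.add (Continuous.if_le (by fun_prop) (by fun_prop) (by fun_prop) (by fun_prop)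
      (by rintro x rfl; simp))
  exact hc.continuousAt.congr ((eventually_eq_of_germs hr hl).mono fun s hs => hs.symm)

lemma isPiecewiseLinear_of_germs {f : ℝ → ℝ} (hf : ∀ t, HasUnitGerm f t 1 ∧ HasUnitGerm f t (-1))
    (hfin : {t : ℝ | ¬ DifferentiableAt ℝ f t}.Finite) : IsPiecewiseLinear f := by
  have hcont : Continuous f :=
    continuous_iff_continuousAt.2 fun t => continuousAt_of_germ (hf t).1 (hf t).2
  refine ⟨hfin.toFinset, fun x y hxy hS => ?_⟩
  rcases hxy.eq_or_lt with rfl | hlt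
  · exact ⟨0, f x, fun t ht => by rw [Icc_self] at ht; rw [ht]; ring⟩
  have hd : ∀ t ∈ Ioo x y, DifferentiableAt ℝ f t := fun t ht => by
    by_contra hn
    exact hS t (hfin.mem_toFinset.2 hn) ht
  have hloc : ∀ t ∈ Ioo x y, deriv f =ᶠ[𝓝 t] fun _ => deriv f t := fun t ht => by
    have h := (exists_affine_of_differentiableAt (hf t).1 (hf t).2 (hd t ht)).2.eventually_nhds
    filter_upwards [h] with s hs
    rw [EventuallyEq.deriv_eq hs]
    simp
  obtain ⟨m, hm⟩ := isOpen_Ioo.exists_is_const_of_deriv_eq_zero isPreconnected_Ioo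
    (f := deriv f) (s := Ioo x y)
    (fun t ht => (DifferentiableAt.congr_of_eventuallyEq (by fun_prop)
      (hloc t ht)).differentiableWithinAt)
    (fun t ht => by rw [(hloc t ht).deriv_eq]; simp)
  have hg : ∀ t ∈ Ioo x y, HasDerivAt (fun s => f s - m * s) 0 t := fun t ht => by
    have h1 := (hd t ht).hasDerivAt.fun_sub ((hasDerivAt_id t).const_mul m)
    rw [hm t ht, mul_one, sub_self] at h1
    exact h1
  obtain ⟨c, hc⟩ := isOpen_Ioo.exists_is_const_of_deriv_eq_zero isPreconnected_Ioo
    (f := fun s => f s - m * s) (s := Ioo x y)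
    (fun t ht => (hg t ht).differentiableAt.differentiableWithinAt) (fun t ht => (hg t ht).deriv)
  have heq : EqOn f (fun t => m * t + c) (Ioo x y) := fun t ht => by
    have := hc t ht
    show f t = m * t + c
    linarith
  have := heq.closure hcont (by fun_prop)
  rw [closure_Ioo hlt.ne] at this
  exact ⟨m, c, this⟩

/-- A nonnegative function with compact support and unit germs at every point is a landscape curve:
its critical points cannot accumulate, so compactness leaves finitely many. -/
lemma isLandscapeCurve_of_germs {f : ℝ → ℝ} (h0 : ∀ t, 0 ≤ f t) (hs : HasCompactSupport f)
    (hf : ∀ t, HasUnitGerm f t 1 ∧ HasUnitGerm f t (-1)) : IsLandscapeCurve f := by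
  have hfin : {t : ℝ | ¬ DifferentiableAt ℝ f t}.Finite := by
    by_contra hinf
    have hsub : {t : ℝ | ¬ DifferentiableAt ℝ f t} ⊆ tsupport f := fun t ht => by
      by_contra hn
      exact ht (DifferentiableAt.congr_of_eventuallyEq (differentiableAt_const 0)
        (notMem_tsupport_iff_eventuallyEq.1 hn))
    obtain ⟨t, -, ht⟩ := Set.Infinite.exists_accPt_of_subset_isCompact hinf hs hsub
    rw [accPt_iff_frequently_nhdsNE] at ht
    exact ht ((differentiableAt_near_of_germ (hf t).1 (hf t).2).mono fun s hs => by simpa using hs)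
  refine ⟨h0, continuous_iff_continuousAt.2 fun t => continuousAt_of_germ (hf t).1 (hf t).2,
    isPiecewiseLinear_of_germs hf hfin, hs, hfin, fun t ht hd => ?_⟩
  obtain ⟨h | h | ⟨h, h'⟩, he⟩ := exists_affine_of_differentiableAt (hf t).1 (hf t).2 hd
  · exact Or.inl h
  · exact Or.inr h
  · refine absurd ht (notMem_tsupport_iff_eventuallyEq.2 ?_)
    filter_upwards [he] with s hs
    simp [hs, h, h']

/-- Next to every point a landscape curve is affine; its slope is `1` or `-1` unless it vanishes
there. -/
lemma IsLandscapeCurve.hasUnitGerm {f : ℝ → ℝ} (hf : IsLandscapeCurve f) (t : ℝ) {u : ℝ}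
    (hu : u = 1 ∨ u = -1) : HasUnitGerm f t u := by
  obtain ⟨S, hS⟩ := hf.piecewiseLinear
  -- an interval on the chosen side of `t` without break points in its interior
  have hgap : ∀ᶠ ε in 𝓝[>] (0 : ℝ), ∀ s ∈ S, s ≠ t → ε < |s - t| := by
    refine (eventually_all_finset S).2 fun s _ => ?_
    by_cases hst : s = t
    · exact Eventually.of_forall fun _ h => absurd hst h
    · filter_upwards [nhdsWithin_le_nhds (gt_mem_nhds (abs_pos.2 (sub_ne_zero.2 hst)))]
        with ε he _ using he
  obtain ⟨δ, hδ, hδ0⟩ := (hgap.and self_mem_nhdsWithin).exists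
  have hδ0 : 0 < δ := hδ0
  obtain ⟨m, c, hmc⟩ : ∃ m c : ℝ, ∀ ε ∈ Icc 0 δ, f (t + u * ε) = m * (t + u * ε) + c := by
    rcases hu with rfl | rfl
    · obtain ⟨m, c, h⟩ := hS t (t + δ) (by linarith) (fun s hs hm => by
        have := hδ s hs hm.1.ne'
        rw [abs_of_pos (by linarith [hm.1])] at this
        linarith [hm.2])
      exact ⟨m, c, fun ε he => h _ ⟨by linarith [he.1], by linarith [he.2]⟩⟩
    · obtain ⟨m, c, h⟩ := hS (t - δ) t (by linarith) (fun s hs hm => by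
        have := hδ s hs hm.2.ne
        rw [abs_of_neg (by linarith [hm.2])] at this
        linarith [hm.1])
      exact ⟨m, c, fun ε he => h _ ⟨by linarith [he.2], by linarith [he.1]⟩⟩
  have hft : f t = m * t + c := by simpa using hmc 0 ⟨le_rfl, hδ0.le⟩
  have hu2 : u * u = 1 := by rcases hu with rfl | rfl <;> norm_num
  -- at an inner point where `f` is nonzero the slope is the derivative there
  have hkey : ∀ ε ∈ Ioo 0 δ, f (t + u * ε) ≠ 0 → m = 1 ∨ m = -1 := by
    intro ε he hne
    have hloc : f =ᶠ[𝓝 (t + u * ε)] fun s => m * s + c := by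
      have hc : Continuous fun s : ℝ => u * (s - t) := by fun_prop
      have : (fun s : ℝ => u * (s - t)) ⁻¹' Ioo 0 δ ∈ 𝓝 (t + u * ε) :=
        hc.continuousAt.preimage_mem_nhds (Ioo_mem_nhds (by
          have : u * (t + u * ε - t) = ε := by linear_combination ε * hu2
          rw [this]; exact he.1) (by
          have : u * (t + u * ε - t) = ε := by linear_combination ε * hu2
          rw [this]; exact he.2))
      filter_upwards [this] with s hs
      have h := hmc _ ⟨hs.1.le, hs.2.le⟩
      have e : t + u * (u * (s - t)) = s := by linear_combination (s - t) * hu2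
      rwa [e] at h
    have hd : HasDerivAt f m (t + u * ε) := by
      refine HasDerivAt.congr_of_eventuallyEq ?_ hloc
      simpa using ((hasDerivAt_id (t + u * ε)).const_mul m).add_const c
    have := hf.deriv_eq _ (subset_tsupport f hne) hd.differentiableAt
    rwa [hd.deriv] at this
  refine ⟨m * u, ?_, ?_⟩
  · by_cases h1 : f (t + u * (δ / 2)) = 0
    · by_cases h2 : f (t + u * (δ / 3)) = 0
      · rw [hmc _ ⟨by positivity, by linarith⟩] at h1 h2
        have h3 : m * u * δ = 0 := by linear_combination 6 * (h1 - h2)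
        have h4 : m * u = 0 := by simpa [hδ0.ne'] using h3
        exact Or.inr (Or.inr ⟨h4, by rw [hft]; linear_combination h1 - δ / 2 * h4⟩)
      · rcases hkey _ ⟨by positivity, by linarith⟩ h2 with rfl | rfl <;>
          rcases hu with rfl | rfl <;> norm_num
    · rcases hkey _ ⟨by positivity, by linarith⟩ h1 with rfl | rfl <;>
          rcases hu with rfl | rfl <;> norm_num
  · filter_upwards [Ioo_mem_nhdsGT hδ0] with ε he
    rw [hmc ε ⟨he.1.le, he.2.le⟩, hft]; ring

lemma isLandscapeCurve_zero : IsLandscapeCurve (fun _ => 0) :=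
  isLandscapeCurve_of_germs (fun _ => le_rfl) HasCompactSupport.zero
    fun t => ⟨hasUnitGerm_zero t 1, hasUnitGerm_zero t (-1)⟩

lemma IsLandscapeCurve.sup {f g : ℝ → ℝ} (hf : IsLandscapeCurve f) (hg : IsLandscapeCurve g) :
    IsLandscapeCurve (fun t => max (f t) (g t)) :=
  isLandscapeCurve_of_germs (fun t => le_max_of_le_left (hf.nonneg t))
    (hf.compactSupport.comp₂_left hg.compactSupport (m := max) (max_self 0)) fun t =>
    ⟨(hf.hasUnitGerm t (Or.inl rfl)).sup (hg.hasUnitGerm t (Or.inl rfl)),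
      (hf.hasUnitGerm t (Or.inr rfl)).sup (hg.hasUnitGerm t (Or.inr rfl))⟩

lemma IsLandscapeCurve.inf {f g : ℝ → ℝ} (hf : IsLandscapeCurve f) (hg : IsLandscapeCurve g) :
    IsLandscapeCurve (fun t => min (f t) (g t)) :=
  isLandscapeCurve_of_germs (fun t => le_min (hf.nonneg t) (hg.nonneg t))
    (hf.compactSupport.comp₂_left hg.compactSupport (m := min) (min_self 0)) fun t =>
    ⟨(hf.hasUnitGerm t (Or.inl rfl)).inf (hg.hasUnitGerm t (Or.inl rfl)),
      (hf.hasUnitGerm t (Or.inr rfl)).inf (hg.hasUnitGerm t (Or.inr rfl))⟩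

lemma tent_eq (b d t : ℝ) : tent b d t = max 0 (min (t - b) (d - t)) := by
  unfold tent
  split_ifs with h1 h2
  · rw [min_eq_left (by linarith), max_eq_right (by linarith)]
  · rw [min_eq_right (by linarith), max_eq_right (by linarith)]
  · rw [max_eq_left]
    by_contra! h
    obtain ⟨h3, h4⟩ := lt_min_iff.1 h
    rcases le_or_gt t ((b + d) / 2) with h5 | h5
    · exact h1 ⟨by linarith, h5⟩
    · exact h2 ⟨h5, by linarith⟩

lemma isLandscapeCurve_tent (b d : ℝ) : IsLandscapeCurve (tent b d) := by
  have e : tent b d = fun t => max 0 (min (t - b) (d - t)) := funext (tent_eq b d)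
  have hg : ∀ u : ℝ, u = 1 ∨ u = -1 → ∀ t, HasUnitGerm (tent b d) t u := fun u hu t => by
    rw [e]
    exact (hasUnitGerm_zero t u).sup
      ((hasUnitGerm_of_affine (m := 1) (c := -b) (fun t => by ring) (Or.inl rfl) hu t).inf
        (hasUnitGerm_of_affine (m := -1) (c := d) (fun t => by ring) (Or.inr rfl) hu t))
  refine isLandscapeCurve_of_germs (fun t => by rw [tent_eq]; exact le_max_left _ _) ?_
    fun t => ⟨hg 1 (Or.inl rfl) t, hg (-1) (Or.inr rfl) t⟩
  refine HasCompactSupport.intro (isCompact_Icc (a := b) (b := d)) fun t ht => ?_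
  rw [tent_eq, max_eq_left]
  by_contra! h
  obtain ⟨h3, h4⟩ := lt_min_iff.1 h
  exact ht ⟨by linarith, by linarith⟩

/-! ### Order statistics -/

lemma le_getD_iff_lt_countP {x : ℝ} (hx : 0 < x) {l : List ℝ} (hl : l.Pairwise (· ≥ ·)) (k : ℕ) :
    x ≤ l.getD k 0 ↔ k < l.countP (x ≤ ·) := by
  induction l generalizing k with
  | nil => simpa using hx
  | cons a l ih =>
    obtain ⟨ha, hl⟩ := List.pairwise_cons.1 hl
    by_cases hxa : x ≤ a
    · cases k with
      | zero => simp [hxa]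
      | succ k => simpa [hxa] using ih hl k
    · have h0 : l.countP (x ≤ ·) = 0 := by
        rw [List.countP_eq_zero]
        intro y hy
        have := ha y hy
        simp only [decide_eq_true_eq, not_le]
        exact lt_of_le_of_lt this (not_le.1 hxa)
      cases k with
      | zero => simp [hxa, h0]
      | succ k =>
        have := ih hl k
        rw [h0] at this
        simpa [hxa, h0] using this

lemma le_kmax_iff {x : ℝ} (hx : 0 < x) (k : ℕ) (s : Multiset ℝ) :
    x ≤ kmax k s ↔ k < s.countP (x ≤ ·) := by
  unfold kmax
  rw [le_getD_iff_lt_countP hx (s.pairwise_sort (· ≥ ·)), ← Multiset.coe_countP, Multiset.sort_eq]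

lemma kmax_nonneg {s : Multiset ℝ} (hs : ∀ x ∈ s, 0 ≤ x) (k : ℕ) : 0 ≤ kmax k s := by
  unfold kmax
  rcases lt_or_ge k (s.sort (· ≥ ·)).length with h | h
  · rw [List.getD_eq_getElem _ _ h]
    exact hs _ (Multiset.mem_sort (r := (· ≥ ·)).1 (List.getElem_mem h))
  · rw [List.getD_eq_default _ _ h]

/-- Nonnegative numbers are determined by the positive numbers below them. -/
lemma eq_of_forall_pos_le_iff {a b : ℝ} (ha : 0 ≤ a) (hb : 0 ≤ b)
    (h : ∀ x, 0 < x → (x ≤ a ↔ x ≤ b)) : a = b := by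
  apply le_antisymm
  · rcases ha.eq_or_lt with e | e
    · rwa [← e]
    · exact (h a e).1 le_rfl
  · rcases hb.eq_or_lt with e | e
    · rwa [← e]
    · exact (h b e).2 le_rfl

lemma kmax_zero_cons {a : ℝ} {s : Multiset ℝ} (ha : 0 ≤ a) (hs : ∀ x ∈ s, 0 ≤ x) :
    kmax 0 (a ::ₘ s) = max a (kmax 0 s) := by
  refine eq_of_forall_pos_le_iff (kmax_nonneg (by simpa using ⟨ha, hs⟩) 0)
    (le_max_of_le_left ha) fun x hx => ?_
  rw [le_max_iff, le_kmax_iff hx, le_kmax_iff hx, Multiset.countP_cons]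
  split_ifs with h <;> simp [h]

lemma kmax_succ_cons {a : ℝ} {s : Multiset ℝ} (ha : 0 ≤ a) (hs : ∀ x ∈ s, 0 ≤ x) (k : ℕ) :
    kmax (k + 1) (a ::ₘ s) = max (kmax (k + 1) s) (min a (kmax k s)) := by
  refine eq_of_forall_pos_le_iff (kmax_nonneg (by simpa using ⟨ha, hs⟩) _)
    (le_max_of_le_left (kmax_nonneg hs _)) fun x hx => ?_
  rw [le_max_iff, le_min_iff, le_kmax_iff hx, le_kmax_iff hx, le_kmax_iff hx, Multiset.countP_cons]
  split_ifs with h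
  · simp only [h, true_and]; omega
  · simp [h]

/-- Adjoining an element changes the order statistics only through maxima and minima, which preserve
landscape curves. -/
lemma isLandscapeCurve_kmax (M : Multiset (ℝ → ℝ)) (hM : ∀ f ∈ M, IsLandscapeCurve f) (k : ℕ) :
    IsLandscapeCurve fun t => kmax k (M.map fun f => f t) := by
  induction M using Multiset.induction_on generalizing k with
  | empty => simpa [kmax] using isLandscapeCurve_zero
  | cons f M ih =>
    have hf := hM f (Multiset.mem_cons_self f M)
    have hM' : ∀ g ∈ M, IsLandscapeCurve g := fun g hg => hM g (Multiset.mem_cons_of_mem hg)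
    have h0 : ∀ t, ∀ x ∈ M.map fun g => g t, 0 ≤ x := fun t x hx => by
      obtain ⟨g, hg, rfl⟩ := Multiset.mem_map.1 hx
      exact (hM' g hg).nonneg t
    cases k with
    | zero =>
      simp only [Multiset.map_cons, kmax_zero_cons (hf.nonneg _) (h0 _)]
      exact hf.sup (ih hM' 0)
    | succ k =>
      simp only [Multiset.map_cons, kmax_succ_cons (hf.nonneg _) (h0 _)]
      exact (ih hM' (k + 1)).sup (hf.inf (ih hM' k))

lemma isLandscapeCurve_directSum {η μ : ℕ → ℝ → ℝ} (hη : ∀ k, IsLandscapeCurve (η k))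
    (hμ : ∀ k, IsLandscapeCurve (μ k)) (k : ℕ) : IsLandscapeCurve (directSum η μ k) := by
  have := isLandscapeCurve_kmax ((Multiset.range (k + 1)).map η + (Multiset.range (k + 1)).map μ)
    (fun f hf => by
      rcases Multiset.mem_add.1 hf with h | h <;> obtain ⟨i, -, rfl⟩ := Multiset.mem_map.1 h
      exacts [hη i, hμ i]) k
  simp only [Multiset.map_add, Multiset.map_map] at this
  exact this

/-! ### The rank function -/

/-- The number of members of the sequence whose graph passes on or above the point `(t, h)`. -/
noncomputable def rank (lam : ℕ → ℝ → ℝ) (t h : ℝ) : ℕ := {k : ℕ | h ≤ lam k t}.ncard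

lemma le_iff_lt_rank {lam : ℕ → ℝ → ℝ} (hmono : ∀ k t, lam (k + 1) t ≤ lam k t)
    (hfin : ∃ K : ℕ, ∀ k, K ≤ k → lam k = 0) {t h : ℝ} (hh : 0 < h) (k : ℕ) :
    h ≤ lam k t ↔ k < rank lam t h := by
  have hanti : Antitone fun k => lam k t := antitone_nat_of_succ_le fun k => hmono k t
  have hex : ∃ k, lam k t < h := by
    obtain ⟨K, hK⟩ := hfin
    exact ⟨K, by simpa [hK K le_rfl] using hh⟩
  have hiff : ∀ k, h ≤ lam k t ↔ k < Nat.find hex := fun k => by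
    rw [Nat.lt_find_iff]
    exact ⟨fun hk m hm => not_lt.2 (hk.trans (hanti hm)), fun hk => not_lt.1 (hk k le_rfl)⟩
  have : rank lam t h = Nat.find hex := by
    unfold rank
    have e : {k : ℕ | h ≤ lam k t} = Iio (Nat.find hex) := by
      ext k; exact hiff k
    rw [e, ← Finset.coe_Iio, Set.ncard_coe_finset, Nat.card_Iio]
  rw [this, hiff]

lemma countP_lt_range (n m : ℕ) : (Multiset.range m).countP (· < n) = min m n := by
  induction m with
  | zero => simp
  | succ m ih =>
    rw [Multiset.range_succ, Multiset.countP_cons, ih]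
    split_ifs <;> omega

lemma le_directSum_iff {η μ : ℕ → ℝ → ℝ} (hη : IsLandscapeSequence η) (hμ : IsLandscapeSequence μ)
    {t h : ℝ} (hh : 0 < h) (k : ℕ) :
    h ≤ directSum η μ k t ↔ k < rank η t h + rank μ t h := by
  unfold directSum
  rw [le_kmax_iff hh, Multiset.countP_add, Multiset.countP_map, Multiset.countP_map]
  simp only [le_iff_lt_rank hη.monotonicity hη.finite_support hh,
    le_iff_lt_rank hμ.monotonicity hμ.finite_support hh]
  rw [← Multiset.countP_eq_card_filter, ← Multiset.countP_eq_card_filter, countP_lt_range,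
    countP_lt_range]
  omega

lemma rank_directSum {η μ : ℕ → ℝ → ℝ} (hη : IsLandscapeSequence η) (hμ : IsLandscapeSequence μ)
    {t h : ℝ} (hh : 0 < h) : rank (directSum η μ) t h = rank η t h + rank μ t h := by
  have e : {k : ℕ | h ≤ directSum η μ k t} = Iio (rank η t h + rank μ t h) := by
    ext k; exact le_directSum_iff hη hμ hh k
  rw [rank, e, ← Finset.coe_Iio, Set.ncard_coe_finset, Nat.card_Iio]

lemma directSum_succ_le {η μ : ℕ → ℝ → ℝ} (hη : IsLandscapeSequence η)
    (hμ : IsLandscapeSequence μ) (k : ℕ) (t : ℝ) :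
    directSum η μ (k + 1) t ≤ directSum η μ k t := by
  rcases ((isLandscapeCurve_directSum hη.curve hμ.curve (k + 1)).nonneg t).eq_or_lt with h | h
  · rw [← h]
    exact (isLandscapeCurve_directSum hη.curve hμ.curve k).nonneg t
  · have := (le_directSum_iff hη hμ h (k + 1)).1 le_rfl
    exact (le_directSum_iff hη hμ h k).2 (by omega)

lemma directSum_eventually_zero {η μ : ℕ → ℝ → ℝ} (hη : IsLandscapeSequence η)
    (hμ : IsLandscapeSequence μ) : ∃ K : ℕ, ∀ k, K ≤ k → directSum η μ k = 0 := by
  obtain ⟨K, hK⟩ := hη.finite_support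
  obtain ⟨K', hK'⟩ := hμ.finite_support
  refine ⟨K + K', fun k hk => funext fun t => ?_⟩
  refine eq_of_forall_pos_le_iff ((isLandscapeCurve_directSum hη.curve hμ.curve k).nonneg t)
    le_rfl fun x hx => iff_of_false (fun hle => ?_) (not_le.2 hx)
  have h1 := (le_directSum_iff hη hμ hx k).1 hle
  have h2 : ¬ K < rank η t x := fun h => by
    have := (le_iff_lt_rank hη.monotonicity hη.finite_support hx K).2 h
    rw [hK K le_rfl] at this
    exact not_le.2 hx this
  have h3 : ¬ K' < rank μ t x := fun h => by
    have := (le_iff_lt_rank hμ.monotonicity hμ.finite_support hx K').2 h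
    rw [hK' K' le_rfl] at this
    exact not_le.2 hx this
  omega

/-! ### The corner form of the rank function and the degree -/

open Classical in
/-- The indicator of a proposition, as an integer. -/
noncomputable def ind (P : Prop) : ℤ := if P then 1 else 0

lemma ind_of_true {P : Prop} (h : P) : ind P = 1 := if_pos h

lemma ind_of_false {P : Prop} (h : ¬ P) : ind P = 0 := if_neg h

/-- In the coordinates `b = t - h`, `d = t + h`, near `(t, h)` the function `F` is a linear
combination of `1`, the indicators of the two half-planes through `(t, h)`, and the indicator of the
quadrant below `(t, h)`. The coefficient of the quadrant is `δ`. -/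
def HasCorner (F : ℝ → ℝ → ℤ) (t h : ℝ) (δ : ℤ) : Prop :=
  ∃ C P Q : ℤ, ∀ᶠ p : ℝ × ℝ in 𝓝 (t, h), F p.1 p.2 =
    C + P * ind (t - h ≤ p.1 - p.2) + Q * ind (p.1 + p.2 ≤ t + h) +
      δ * ind (t - h ≤ p.1 - p.2 ∧ p.1 + p.2 ≤ t + h)

lemma HasCorner.add {F G : ℝ → ℝ → ℤ} {t h : ℝ} {δ δ' : ℤ} (hF : HasCorner F t h δ)
    (hG : HasCorner G t h δ') : HasCorner (fun s y => F s y + G s y) t h (δ + δ') := by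
  obtain ⟨C, P, Q, hF⟩ := hF
  obtain ⟨C', P', Q', hG⟩ := hG
  refine ⟨C + C', P + P', Q + Q', ?_⟩
  filter_upwards [hF, hG] with p h1 h2
  rw [h1, h2]; ring

lemma HasCorner.neg {F : ℝ → ℝ → ℤ} {t h : ℝ} {δ : ℤ} (hF : HasCorner F t h δ) :
    HasCorner (fun s y => -F s y) t h (-δ) := by
  obtain ⟨C, P, Q, hF⟩ := hF
  refine ⟨-C, -P, -Q, ?_⟩
  filter_upwards [hF] with p h1
  rw [h1]; ring

lemma HasCorner.sum {ι : Type*} (s : Finset ι) {F : ι → ℝ → ℝ → ℤ} {t h : ℝ} {δ : ι → ℤ}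
    (hF : ∀ i ∈ s, HasCorner (F i) t h (δ i)) :
    HasCorner (fun x y => ∑ i ∈ s, F i x y) t h (∑ i ∈ s, δ i) := by
  classical
  induction s using Finset.induction_on with
  | empty => exact ⟨0, 0, 0, Eventually.of_forall fun p => by simp⟩
  | insert i s hi ih =>
    simp only [Finset.sum_insert hi]
    exact (hF i (Finset.mem_insert_self i s)).add
      (ih fun j hj => hF j (Finset.mem_insert_of_mem hj))

lemma HasCorner.congr {F G : ℝ → ℝ → ℤ} {t h : ℝ} {δ : ℤ} (hF : HasCorner F t h δ)
    (hFG : ∀ᶠ p : ℝ × ℝ in 𝓝 (t, h), G p.1 p.2 = F p.1 p.2) : HasCorner G t h δ := by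
  obtain ⟨C, P, Q, hF⟩ := hF
  refine ⟨C, P, Q, ?_⟩
  filter_upwards [hF, hFG] with p h1 h2
  rw [h2, h1]

lemma tendsto_ray_prod (t h u v : ℝ) :
    Tendsto (fun ε : ℝ => (t + u * ε, h + v * ε)) (𝓝[>] (0 : ℝ)) (𝓝 (t, h)) :=
  (tendsto_ray t u).prodMk_nhds (tendsto_ray h v)

/-- If `F` vanishes above the height `h`, then near `(t, h)` only the quadrant term survives:
points slightly above the line of height `h` see the other three coefficients separately. -/
lemma HasCorner.eq_of_vanishing {F : ℝ → ℝ → ℤ} {t h : ℝ} {δ : ℤ} (hF : HasCorner F t h δ)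
    (h0 : ∀ s y, h < y → F s y = 0) :
    ∀ᶠ p : ℝ × ℝ in 𝓝 (t, h),
      F p.1 p.2 = δ * ind (t - h ≤ p.1 - p.2 ∧ p.1 + p.2 ≤ t + h) := by
  obtain ⟨C, P, Q, hF⟩ := hF
  obtain ⟨ε, ⟨⟨h1, h2⟩, h3⟩, hε⟩ := ((((tendsto_ray_prod t h 0 2).eventually hF).and
    ((tendsto_ray_prod t h 1 1).eventually hF)).and
    ((tendsto_ray_prod t h (-1) 1).eventually hF) |>.and self_mem_nhdsWithin).exists
  have hε : 0 < ε := hε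
  rw [h0 _ _ (by simp only; linarith), ind_of_false (by simp only; linarith),
    ind_of_false (by simp only; linarith),
    ind_of_false (fun hc => by have := hc.1; simp only at this; linarith)] at h1
  rw [h0 _ _ (by simp only; linarith), ind_of_true (by simp only; linarith),
    ind_of_false (by simp only; linarith),
    ind_of_false (fun hc => by have := hc.2; simp only at this; linarith)] at h2
  rw [h0 _ _ (by simp only; linarith), ind_of_false (by simp only; linarith),
    ind_of_true (by simp only; linarith),
    ind_of_false (fun hc => by have := hc.1; simp only at this; linarith)] at h3
  have hC : C = 0 := by linarith
  have hP : P = 0 := by linarith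
  have hQ : Q = 0 := by linarith
  filter_upwards [hF] with p hp
  rw [hp, hC, hP, hQ]; ring

/-- The coefficient of the quadrant is the mixed second difference of `F` at `(t, h)`. -/
lemma HasCorner.unique {F : ℝ → ℝ → ℤ} {t h : ℝ} {δ δ' : ℤ} (hF : HasCorner F t h δ)
    (hF' : HasCorner F t h δ') : δ = δ' := by
  have key : HasCorner (fun _ _ => 0) t h (δ - δ') :=
    (hF.add hF'.neg).congr (Eventually.of_forall fun p => by ring)
  have := (key.eq_of_vanishing fun _ _ _ => rfl).self_of_nhds
  rw [ind_of_true ⟨le_rfl, le_rfl⟩] at this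
  linarith

lemma not_isLocalMax_of_germ {f : ℝ → ℝ} {t u : ℝ}
    (hf : ∀ᶠ ε in 𝓝[>] (0 : ℝ), f (t + u * ε) = f t + 1 * ε) : ¬ IsLocalMax f t := fun h => by
  obtain ⟨ε, ⟨h1, h2⟩, hε⟩ :=
    ((hf.and ((tendsto_ray t u).eventually h)).and self_mem_nhdsWithin).exists
  have hε : 0 < ε := hε
  linarith

lemma not_isLocalMin_of_germ {f : ℝ → ℝ} {t u : ℝ}
    (hf : ∀ᶠ ε in 𝓝[>] (0 : ℝ), f (t + u * ε) = f t + -1 * ε) : ¬ IsLocalMin f t := fun h => by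
  obtain ⟨ε, ⟨h1, h2⟩, hε⟩ :=
    ((hf.and ((tendsto_ray t u).eventually h)).and self_mem_nhdsWithin).exists
  have hε : 0 < ε := hε
  linarith

/-- The region on or below the graph of a single curve has corner coefficient `1` at local maxima,
`-1` at local minima and `0` at all other points. -/
lemma IsLandscapeCurve.hasCorner {f : ℝ → ℝ} (hf : IsLandscapeCurve f) {t h : ℝ} (hh : 0 < h) :
    HasCorner (fun s y => ind (y ≤ f s)) t h
      (ind (f t = h ∧ IsLocalMax f t) - ind (f t = h ∧ IsLocalMin f t)) := by
  have hc : Continuous fun p : ℝ × ℝ => f p.1 := hf.continuous.comp continuous_fst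
  rcases lt_trichotomy (f t) h with hlt | heq | hgt
  · rw [ind_of_false fun h => hlt.ne h.1, ind_of_false fun h => hlt.ne h.1]
    refine ⟨0, 0, 0, ?_⟩
    filter_upwards [hc.continuousAt.eventually_lt continuous_snd.continuousAt
      (show f (t, h).1 < (t, h).2 from hlt)] with p hp
    rw [ind_of_false (not_le.2 hp)]; ring
  · obtain ⟨σ, hσ, hr⟩ := hf.hasUnitGerm t (u := 1) (Or.inl rfl)
    obtain ⟨τ, hτ, hl⟩ := hf.hasUnitGerm t (u := -1) (Or.inr rfl)
    have hne : f t ≠ 0 := by rw [heq]; exact hh.ne'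
    replace hσ : σ = 1 ∨ σ = -1 := by tauto
    replace hτ : τ = 1 ∨ τ = -1 := by tauto
    have hE := eventually_eq_of_germs hr hl
    have hE' : ∀ᶠ p : ℝ × ℝ in 𝓝 (t, h),
        f p.1 = h + if t ≤ p.1 then σ * (p.1 - t) else τ * (t - p.1) := by
      rw [← heq]
      exact (continuous_fst.tendsto (t, f t)).eventually hE
    rcases hσ with rfl | rfl <;> rcases hτ with rfl | rfl
    · have hmin : IsLocalMin f t := by
        filter_upwards [hE] with s hs
        rw [hs]; split_ifs <;> linarith
      rw [ind_of_false fun h => not_isLocalMax_of_germ hr h.2, ind_of_true ⟨heq, hmin⟩]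
      refine ⟨0, 1, 1, ?_⟩
      filter_upwards [hE'] with p hp
      rw [hp]
      unfold ind
      split_ifs <;> grind
    · rw [ind_of_false fun h => not_isLocalMax_of_germ hr h.2,
        ind_of_false fun h => not_isLocalMin_of_germ hl h.2]
      refine ⟨0, 1, 0, ?_⟩
      filter_upwards [hE'] with p hp
      rw [hp]
      unfold ind
      split_ifs <;> grind
    · rw [ind_of_false fun h => not_isLocalMax_of_germ hl h.2,
        ind_of_false fun h => not_isLocalMin_of_germ hr h.2]
      refine ⟨0, 0, 1, ?_⟩
      filter_upwards [hE'] with p hp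
      rw [hp]
      unfold ind
      split_ifs <;> grind
    · have hmax : IsLocalMax f t := by
        filter_upwards [hE] with s hs
        rw [hs]; split_ifs <;> linarith
      rw [ind_of_true ⟨heq, hmax⟩, ind_of_false fun h => not_isLocalMin_of_germ hr h.2]
      refine ⟨0, 0, 0, ?_⟩
      filter_upwards [hE'] with p hp
      rw [hp]
      unfold ind
      split_ifs <;> grind
  · rw [ind_of_false fun h => hgt.ne' h.1, ind_of_false fun h => hgt.ne' h.1]
    refine ⟨1, 0, 0, ?_⟩
    filter_upwards [continuous_snd.continuousAt.eventually_lt hc.continuousAt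
      (show (t, h).2 < f (t, h).1 from hgt)] with p hp
    rw [ind_of_true (le_of_lt hp)]; ring

lemma ncard_eq_sum_ind {P : ℕ → Prop} {K : ℕ} (hP : ∀ k, P k → k < K) :
    ({k : ℕ | P k}.ncard : ℤ) = ∑ k ∈ Finset.range K, ind (P k) := by
  classical
  have e : {k : ℕ | P k} = ((Finset.range K).filter P : Finset ℕ) := by
    ext k
    simpa using hP k
  rw [e, Set.ncard_coe_finset, Finset.card_filter]
  push_cast
  exact Finset.sum_congr rfl fun k _ => by unfold ind; congr

/-- The degree at a point of positive height is a local invariant of the rank function. Only the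
shape of the curves enters, not their ordering or the sign of the degree. -/
lemma hasCorner_rank {lam : ℕ → ℝ → ℝ} (hc : ∀ k, IsLandscapeCurve (lam k))
    (hfin : ∃ K : ℕ, ∀ k, K ≤ k → lam k = 0) {t h : ℝ} (hh : 0 < h) :
    HasCorner (fun s y => (rank lam s y : ℤ)) t h (degree lam t h) := by
  obtain ⟨K, hK⟩ := hfin
  have hlt : ∀ {k : ℕ} {s y : ℝ}, 0 < y → y ≤ lam k s → k < K := fun {k s y} hy hle => by
    by_contra hn
    rw [hK k (not_lt.1 hn)] at hle
    exact not_le.2 hy hle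
  have hdeg : degree lam t h = ∑ k ∈ Finset.range K,
      (ind (lam k t = h ∧ IsLocalMax (lam k) t) - ind (lam k t = h ∧ IsLocalMin (lam k) t)) := by
    rw [degree, ncard_eq_sum_ind (K := K) fun k hk => hlt hh hk.1.ge,
      ncard_eq_sum_ind (K := K) fun k hk => hlt hh hk.1.ge, Finset.sum_sub_distrib]
  rw [hdeg]
  refine (HasCorner.sum (Finset.range K) fun k _ => (hc k).hasCorner hh).congr ?_
  filter_upwards [continuous_snd.continuousAt.eventually (lt_mem_nhds hh)] with p hp
  exact ncard_eq_sum_ind (K := K) fun k hk => hlt hp hk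

lemma degree_directSum {η μ : ℕ → ℝ → ℝ} (hη : IsLandscapeSequence η) (hμ : IsLandscapeSequence μ)
    {t h : ℝ} (hh : 0 < h) : degree (directSum η μ) t h = degree η t h + degree μ t h := by
  refine (hasCorner_rank (isLandscapeCurve_directSum hη.curve hμ.curve)
    (directSum_eventually_zero hη hμ) hh).unique ?_
  refine ((hasCorner_rank hη.curve hη.finite_support hh).add
    (hasCorner_rank hμ.curve hμ.finite_support hh)).congr ?_
  filter_upwards [continuous_snd.continuousAt.eventually (lt_mem_nhds hh)] with p hp
  rw [rank_directSum hη hμ hp]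
  push_cast
  rfl

lemma isLandscapeSequence_directSum {η μ : ℕ → ℝ → ℝ} (hη : IsLandscapeSequence η)
    (hμ : IsLandscapeSequence μ) : IsLandscapeSequence (directSum η μ) where
  curve := isLandscapeCurve_directSum hη.curve hμ.curve
  monotonicity := directSum_succ_le hη hμ
  finite_support := directSum_eventually_zero hη hμ
  degree_nonneg t h hh := by
    rw [degree_directSum hη hμ hh]
    exact add_nonneg (hη.degree_nonneg t h hh) (hμ.degree_nonneg t h hh)

/-! ### The degree determines the sequence -/

/-- If two sequences have the same degree at every point of positive height, consider a highest
point in the closure of the set where their rank functions differ: the difference of the rank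
functions has no corner there and vanishes above it, hence vanishes near it. -/
lemma eq_of_degree_eq {η μ : ℕ → ℝ → ℝ} (hη : IsLandscapeSequence η) (hμ : IsLandscapeSequence μ)
    (hdeg : ∀ t h : ℝ, 0 < h → degree η t h = degree μ t h) : η = μ := by
  suffices hrank : ∀ t h : ℝ, 0 < h → rank η t h = rank μ t h by
    funext k t
    refine eq_of_forall_pos_le_iff ((hη.curve k).nonneg t) ((hμ.curve k).nonneg t) fun x hx => ?_
    rw [le_iff_lt_rank hη.monotonicity hη.finite_support hx,
      le_iff_lt_rank hμ.monotonicity hμ.finite_support hx, hrank t x hx]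
  set S : Set (ℝ × ℝ) := {p | 0 < p.2 ∧ rank η p.1 p.2 ≠ rank μ p.1 p.2}
  have hcurve : IsLandscapeCurve fun t => max (η 0 t) (μ 0 t) := (hη.curve 0).sup (hμ.curve 0)
  obtain ⟨B, hB⟩ := hcurve.continuous.bounded_above_of_compact_support hcurve.compactSupport
  have hsub : S ⊆ tsupport (fun t => max (η 0 t) (μ 0 t)) ×ˢ Icc 0 B := by
    rintro ⟨t, h⟩ ⟨hh, hne⟩
    simp only at hh hne
    have hle : h ≤ max (η 0 t) (μ 0 t) := by
      rw [le_max_iff, le_iff_lt_rank hη.monotonicity hη.finite_support hh,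
        le_iff_lt_rank hμ.monotonicity hμ.finite_support hh]
      omega
    exact ⟨subset_tsupport _ (hh.trans_le hle).ne', hh.le,
      hle.trans ((le_abs_self _).trans (hB t))⟩
  have hcomp : IsCompact (closure S) :=
    (hcurve.compactSupport.isCompact.prod isCompact_Icc).closure_of_subset hsub
  by_contra! hex
  obtain ⟨t₁, h₁, hh₁, hne₁⟩ := hex
  have hmem : (t₁, h₁) ∈ S := ⟨hh₁, hne₁⟩
  obtain ⟨⟨t, h⟩, hth, hmax⟩ :=
    hcomp.exists_isMaxOn ⟨_, subset_closure hmem⟩ continuous_snd.continuousOn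
  have hh : 0 < h := lt_of_lt_of_le hh₁ (hmax (subset_closure hmem))
  have hcorner : HasCorner (fun s y => (rank η s y : ℤ) - rank μ s y) t h 0 := by
    have := (hasCorner_rank hη.curve hη.finite_support (t := t) hh).add
      (hasCorner_rank hμ.curve hμ.finite_support hh).neg
    rw [hdeg t h hh, add_neg_cancel] at this
    exact this.congr (Eventually.of_forall fun p => sub_eq_add_neg _ _)
  have hvan := hcorner.eq_of_vanishing fun s y hy => by
    by_contra hne
    have : (s, y) ∈ S := ⟨hh.trans hy, fun e => hne (by simp [e])⟩
    exact not_le.2 hy (hmax (subset_closure this))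
  obtain ⟨p, hp, hpS⟩ := mem_closure_iff_nhds.1 hth _ hvan
  exact hpS.2 (by simpa [sub_eq_zero] using hp)

/-! ### Direct sums of tents -/

lemma le_tent_iff {b d t h : ℝ} (hh : 0 < h) : h ≤ tent b d t ↔ b ≤ t - h ∧ t + h ≤ d := by
  rw [tent_eq, le_max_iff, le_min_iff, or_iff_right (not_le.2 hh)]
  constructor <;> rintro ⟨h1, h2⟩ <;> constructor <;> linarith

lemma curve_tentSequence (p : BirthDeathPair) (k : ℕ) : IsLandscapeCurve (tentSequence p k) := by
  unfold tentSequence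
  split_ifs
  exacts [isLandscapeCurve_tent _ _, isLandscapeCurve_zero]

lemma tentSequence_eventually_zero (p : BirthDeathPair) :
    ∃ K : ℕ, ∀ k, K ≤ k → tentSequence p k = 0 :=
  ⟨1, fun k hk => if_neg (by omega)⟩

lemma rank_tentSequence (p : BirthDeathPair) {t h : ℝ} (hh : 0 < h) :
    (rank (tentSequence p) t h : ℤ) = ind (p.1.1 ≤ t - h ∧ t + h ≤ p.1.2) := by
  have hlt : ∀ k, h ≤ tentSequence p k t → k < 1 := fun k hk => by
    by_contra hn
    rw [tentSequence, if_neg (by omega)] at hk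
    exact not_le.2 hh hk
  rw [rank, ncard_eq_sum_ind hlt, Finset.sum_range_one, tentSequence, if_pos rfl, le_tent_iff hh]

lemma eventually_ind_eq {P : ℝ × ℝ → Prop} {x : ℝ × ℝ}
    (h : (∀ᶠ p in 𝓝 x, P p) ∨ ∀ᶠ p in 𝓝 x, ¬ P p) :
    ∃ C : ℤ, ∀ᶠ p in 𝓝 x, ind (P p) = C := by
  rcases h with h | h
  exacts [⟨1, h.mono fun p => ind_of_true⟩, ⟨0, h.mono fun p => ind_of_false⟩]

lemma degree_tentSequence (p : BirthDeathPair) {t h : ℝ} (hh : 0 < h) :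
    degree (tentSequence p) t h = ind (p.1.1 = t - h ∧ p.1.2 = t + h) := by
  refine (hasCorner_rank (curve_tentSequence p) (tentSequence_eventually_zero p) hh).unique ?_
  have hpos : ∀ᶠ q : ℝ × ℝ in 𝓝 (t, h), 0 < q.2 :=
    continuous_snd.continuousAt.eventually (lt_mem_nhds hh)
  suffices HasCorner (fun s y => ind (p.1.1 ≤ s - y ∧ s + y ≤ p.1.2)) t h
      (ind (p.1.1 = t - h ∧ p.1.2 = t + h)) from
    this.congr (hpos.mono fun q hq => rank_tentSequence p hq)
  obtain ⟨⟨b, d⟩, hbd⟩ := p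
  have cb : ContinuousAt (fun q : ℝ × ℝ => q.1 - q.2) (t, h) := by fun_prop
  have cd : ContinuousAt (fun q : ℝ × ℝ => q.1 + q.2) (t, h) := by fun_prop
  simp only
  have hand : ∀ A B : Prop, ind (A ∧ B) = ind A * ind B := fun A B => by
    by_cases hA : A <;> by_cases hB : B <;> simp [ind, hA, hB]
  -- away from the boundary lines of the quadrant the corresponding indicator is locally constant
  have hb : b ≠ t - h → ∃ C : ℤ, ∀ᶠ q : ℝ × ℝ in 𝓝 (t, h), ind (b ≤ q.1 - q.2) = C := fun hb =>
    eventually_ind_eq <| hb.lt_or_gt.imp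
      (fun hlt => (cb.eventually (lt_mem_nhds hlt)).mono fun q hq => le_of_lt hq)
      (fun hlt => (cb.eventually (gt_mem_nhds hlt)).mono fun q hq => not_le.2 hq)
  have hd : d ≠ t + h → ∃ C : ℤ, ∀ᶠ q : ℝ × ℝ in 𝓝 (t, h), ind (q.1 + q.2 ≤ d) = C := fun hd =>
    eventually_ind_eq <| hd.lt_or_gt.symm.imp
      (fun hlt => (cd.eventually (gt_mem_nhds hlt)).mono fun q hq => le_of_lt hq)
      (fun hlt => (cd.eventually (lt_mem_nhds hlt)).mono fun q hq => not_le.2 hq)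
  by_cases eb : b = t - h <;> by_cases ed : d = t + h
  · rw [ind_of_true ⟨eb, ed⟩]
    exact ⟨0, 0, 0, Eventually.of_forall fun q => by rw [eb, ed]; ring⟩
  · rw [ind_of_false fun hc => ed hc.2]
    obtain ⟨C, hC⟩ := hd ed
    refine ⟨0, C, 0, hC.mono fun q hq => ?_⟩
    simp only [hand, hq, eb]; ring
  · rw [ind_of_false fun hc => eb hc.1]
    obtain ⟨C, hC⟩ := hb eb
    refine ⟨0, 0, C, hC.mono fun q hq => ?_⟩
    simp only [hand, hq, ed]; ring
  · rw [ind_of_false fun hc => eb hc.1]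
    obtain ⟨C, hC⟩ := hb eb
    obtain ⟨C', hC'⟩ := hd ed
    refine ⟨C * C', 0, 0, (hC.and hC').mono fun q hq => ?_⟩
    simp only [hand, hq.1, hq.2]; ring

lemma isLandscapeSequence_tentSequence (p : BirthDeathPair) :
    IsLandscapeSequence (tentSequence p) where
  curve := curve_tentSequence p
  monotonicity k t := by
    have : tentSequence p (k + 1) t = 0 := by simp [tentSequence]
    rw [this]
    exact (curve_tentSequence p k).nonneg t
  finite_support := tentSequence_eventually_zero p
  degree_nonneg t h hh := by
    rw [degree_tentSequence p hh]
    unfold ind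
    split_ifs <;> norm_num

lemma degree_zero {t h : ℝ} (hh : 0 < h) : degree (0 : ℕ → ℝ → ℝ) t h = 0 := by
  simp [degree, hh.ne]

lemma isLandscapeSequence_tentSum (L : List BirthDeathPair) : IsLandscapeSequence (tentSum L) := by
  induction L with
  | nil => exact ⟨fun _ => isLandscapeCurve_zero, fun _ _ => le_rfl, ⟨0, fun _ _ => rfl⟩,
      fun t h hh => (degree_zero hh).ge⟩
  | cons p L ih => exact isLandscapeSequence_directSum (isLandscapeSequence_tentSequence p) ih

lemma half_length_pos (p : BirthDeathPair) : 0 < (p.1.2 - p.1.1) / 2 := by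
  linarith [p.2]

/-- The multiplicity of a pair in a list can be read off from the direct sum of the list. -/
lemma apexDegree_tentSum (L : List BirthDeathPair) (p : BirthDeathPair) :
    apexDegree (tentSum L) p = L.count p := by
  have hp := half_length_pos p
  induction L with
  | nil => exact degree_zero hp
  | cons q L ih =>
    have h1 : apexDegree (tentSum (q :: L)) p =
        degree (tentSequence q) _ _ + apexDegree (tentSum L) p :=
      degree_directSum (isLandscapeSequence_tentSequence q) (isLandscapeSequence_tentSum L) hp
    rw [h1, ih, degree_tentSequence q hp, List.count_cons, add_comm]
    push_cast
    congr 1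
    have e : (q.1.1 = (p.1.1 + p.1.2) / 2 - (p.1.2 - p.1.1) / 2 ∧
        q.1.2 = (p.1.1 + p.1.2) / 2 + (p.1.2 - p.1.1) / 2) ↔ q = p := by
      rw [Subtype.ext_iff, Prod.ext_iff]
      ring_nf
    rw [e]
    by_cases hqp : q = p
    · simp [ind, hqp]
    · rw [ind_of_false hqp, if_neg (fun hb => hqp (eq_of_beq hb))]

/-- Points of positive height are exactly the apexes of tents. -/
lemma eq_of_apexDegree_eq {η μ : ℕ → ℝ → ℝ} (hη : IsLandscapeSequence η)
    (hμ : IsLandscapeSequence μ) (hdeg : ∀ p, apexDegree η p = apexDegree μ p) : η = μ := by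
  refine eq_of_degree_eq hη hμ fun t h hh => ?_
  have := hdeg ⟨(t - h, t + h), by simp only; linarith⟩
  simp only [apexDegree] at this
  ring_nf at this
  exact this

lemma tentSum_eq_iff_perm (L L' : List BirthDeathPair) : tentSum L = tentSum L' ↔ L'.Perm L := by
  rw [List.perm_iff_count]
  constructor
  · intro h p
    have := apexDegree_tentSum L' p
    rw [← h, apexDegree_tentSum] at this
    exact_mod_cast this.symm
  · intro h
    refine eq_of_apexDegree_eq (isLandscapeSequence_tentSum L) (isLandscapeSequence_tentSum L')
      fun p => ?_
    rw [apexDegree_tentSum, apexDegree_tentSum, h p]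

lemma IsLandscapeCurve.not_differentiableAt {f : ℝ → ℝ} (hf : IsLandscapeCurve f) {t : ℝ}
    (ht : 0 < f t) (he : IsLocalExtr f t) : ¬ DifferentiableAt ℝ f t := fun hd => by
  have := hf.deriv_eq t (subset_tsupport f ht.ne') hd
  rw [he.deriv_eq_zero] at this
  norm_num at this

/-- The degree is carried by the finitely many corners of the curves of the sequence. -/
lemma finite_apexDegree_ne_zero {lam : ℕ → ℝ → ℝ} (h : IsLandscapeSequence lam) :
    {p : BirthDeathPair | apexDegree lam p ≠ 0}.Finite := by
  obtain ⟨K, hK⟩ := h.finite_support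
  have hfin : (⋃ k ∈ Finset.range K, (fun t : ℝ => (t - lam k t, t + lam k t)) ''
      {t | ¬ DifferentiableAt ℝ (lam k) t}).Finite :=
    (Finset.range K).finite_toSet.biUnion fun k _ => (h.curve k).finite_critical.image _
  refine Set.Finite.of_finite_image (hfin.subset ?_) (Subtype.val_injective.injOn)
  rintro _ ⟨p, hp, rfl⟩
  have hpos := half_length_pos p
  obtain ⟨k, hk, he⟩ : ∃ k, lam k ((p.1.1 + p.1.2) / 2) = (p.1.2 - p.1.1) / 2 ∧
      IsLocalExtr (lam k) ((p.1.1 + p.1.2) / 2) := by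
    by_contra! hn
    refine hp ?_
    have h1 : {k | lam k ((p.1.1 + p.1.2) / 2) = (p.1.2 - p.1.1) / 2 ∧
        IsLocalMax (lam k) ((p.1.1 + p.1.2) / 2)} = ∅ :=
      eq_empty_of_forall_notMem fun k hk => hn k hk.1 (Or.inr hk.2)
    have h2 : {k | lam k ((p.1.1 + p.1.2) / 2) = (p.1.2 - p.1.1) / 2 ∧
        IsLocalMin (lam k) ((p.1.1 + p.1.2) / 2)} = ∅ :=
      eq_empty_of_forall_notMem fun k hk => hn k hk.1 (Or.inl hk.2)
    rw [apexDegree, degree, h1, h2, sub_self]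
  have hkK : k < K := by
    by_contra hc
    rw [hK k (not_lt.1 hc)] at hk
    exact hpos.ne hk
  refine mem_biUnion (Finset.mem_coe.2 (Finset.mem_range.2 hkK))
    ⟨_, (h.curve k).not_differentiableAt (hk ▸ hpos) he, ?_⟩
  simp only [hk]
  ext <;> simp only <;> ring

lemma exists_list_count_eq {lam : ℕ → ℝ → ℝ} (h : IsLandscapeSequence lam) :
    ∃ L : List BirthDeathPair, ∀ p, (L.count p : ℤ) = apexDegree lam p := by
  have hfin : (Function.support fun p => (apexDegree lam p).toNat).Finite :=
    (finite_apexDegree_ne_zero h).subset fun p hp h0 => hp (by simp only [h0, Int.toNat_zero])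
  refine ⟨(Finsupp.toMultiset (Finsupp.ofSupportFinite _ hfin)).toList, fun p => ?_⟩
  have hcount : ∀ l : List BirthDeathPair, l.count p = Multiset.count p (l : Multiset _) :=
    fun l => by rw [Multiset.coe_count]; congr 1; exact lawful_beq_subsingleton _ _
  rw [hcount, Multiset.coe_toList, Finsupp.count_toMultiset]
  exact Int.toNat_of_nonneg (h.degree_nonneg _ _ (half_length_pos p))

end Landscape

theorem mainTheorem3 :
    (∀ η μ : ℕ → ℝ → ℝ,
      Landscape.IsLandscapeSequence η → Landscape.IsLandscapeSequence μ →
        Landscape.IsLandscapeSequence (Landscape.directSum η μ)) ∧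
    (∀ lam : ℕ → ℝ → ℝ, Landscape.IsLandscapeSequence lam →
      ∃ L : List Landscape.BirthDeathPair,
        lam = Landscape.tentSum L ∧
        (∀ p ∈ L, 0 < Landscape.apexDegree lam p) ∧
        (∀ p : Landscape.BirthDeathPair, (L.count p : ℤ) = Landscape.apexDegree lam p) ∧
        (∀ L' : List Landscape.BirthDeathPair,
          lam = Landscape.tentSum L' ↔ L'.Perm L)) := by
  refine ⟨fun η μ => Landscape.isLandscapeSequence_directSum, fun lam hlam => ?_⟩
  obtain ⟨L, hL⟩ := Landscape.exists_list_count_eq hlam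
  have hlamL : lam = Landscape.tentSum L :=
    Landscape.eq_of_apexDegree_eq hlam (Landscape.isLandscapeSequence_tentSum L) fun p => by
      rw [Landscape.apexDegree_tentSum, hL p]
  refine ⟨L, hlamL, fun p hp => ?_, hL, fun L' => ?_⟩
  · rw [← hL p]
    exact_mod_cast List.count_pos_iff.2 hp
  · rw [hlamL]
    exact Landscape.tentSum_eq_iff_perm L L'
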